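/- Let $0\le\alpha<1$ and $0\le\beta<1$, and consider the difference equation $x_{n+1}=\alpha+\beta x_{n-1}+x_{n-1}/x_n$ with positive initial values, its equilibrium $\bar x=\frac{1+\alpha}{1-\beta}$, and the associated planar map $T(y,z)=(z,\ \alpha+\beta y+y/z)$ with saddle fixed point $p=(\bar x,\bar x)$. For a neighborhood $N$ of $p$ let $$W^s(p,N)=\{q\in N:\ T^n(q)\in N \text{ for all } n\ge 0,\ T^n(q)\to p \text{ as } n\to\infty\}$$ be the local stable manifold. Put $\theta=\sqrt{1+4\bar x+4\beta\bar x^2}$, $\lambda_1=\frac{-1-\theta}{2\bar x}$, $\lambda_2=\frac{-1+\theta}{2\bar x}$, $\gamma_1=-\frac{1+\beta\bar x}{\theta}$, $\gamma_2=\frac{\theta-1}{2\theta}$, $\gamma_3=\frac{\theta+1}{2\theta}$, $$b_2=\frac{1-\theta+2\beta\bar x}{\theta(\theta-1)(\lambda_2^2-\lambda_1)\bar x},\qquad b_3=\frac{b_2}{(\lambda_2^3-\lambda_1)\bar x}\left[\lambda_1-\lambda_2^2+\frac{1+2\beta\bar x}{\theta\bar x}\left(\frac1{\lambda_2}+\frac{\lambda_2}{\lambda_1}\right)-\frac{\lambda_2}{\lambda_1\bar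 x}\right],$$ $$S(x,y)=\gamma_1(x-\bar x)+\gamma_3(y-\bar x)-b_2\left[\gamma_1(x-\bar x)-\gamma_2(y-\bar x)\right]^2+b_3\left[\gamma_1(x-\bar x)-\gamma_2(y-\bar x)\right]^3,$$ $$f(\xi,\eta)=\frac{(1+2\beta\bar x)(\xi+\eta)^2+\theta(\xi^2-\eta^2)}{\theta(\theta-1)(\xi+\eta+\bar x)},\qquad g(\xi,\eta)=\frac{(1+2\beta\bar x)(\xi+\eta)^2+\theta(\xi^2-\eta^2)}{\theta(\theta+1)(\xi+\eta+\bar x)}.$$ Then there are functions $\psi,w,\tilde\psi:\mathbb R\to\mathbb R$ and a neighborhood $N_0$ of $p$ contained in the open positive quadrant such that: (i) $\psi$ is analytic at $0$ with $\psi(0)=\psi'(0)=0$, and for every neighborhood $N\subseteq N_0$ of $p$, every point of $W^s(p,N)$ has the form $p+\psi(\eta)v_1+\eta v_2$ with $v_1=\left(\frac{-2\bar x}{1+\theta},1\right)$, $v_2=\left(\frac{-2\bar x}{1-\theta},1\right)$, and conversely all such points with $\eta$ close enough to $0$ lie in $W^s(p,N)$; (ii) for all $\eta$ near $0$ one has the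 invariance equation $\psi(\lambda_2\eta+g(\psi(\eta),\eta))=\lambda_1\psi(\eta)+f(\psi(\eta),\eta)$, and $\psi(\eta)=b_2\eta^2+b_3\eta^3+O(\eta^4)$ as $\eta\to0$; (iii) $w$ is analytic at $\bar x$, and for every neighborhood $N\subseteq N_0$ of $p$, every $(x,y)\in W^s(p,N)$ satisfies $x=w(y)$, and conversely $(w(y),y)\in W^s(p,N)$ for all $y$ close enough to $\bar x$; (iv) for $(x,y)$ near $p$ one has $S(x,y)=0$ if and only if $x=\tilde\psi(y)$; in particular $S(\tilde\psi(y),y)=0$ for $y$ near $\bar x$. Moreover $\tilde\psi(\bar x)=\bar x$ and $\tilde\psi'(\bar x)=\frac{2\bar x}{\theta-1}$; (v) the local stable manifold is asymptotically given by $S(\tilde\psi(y),y)=0$: $w(y)=\tilde\psi(y)+O((y-\bar x)^4)$ as $y\to\bar x$. -/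

import Mathlib

open Filter Topology Asymptotics

noncomputable section

namespace SecondOrderEq

/-- The equilibrium `x̄ = (1 + α) / (1 - β)` of `x (n+1) = α + β x (n-1) + x (n-1) / x n`. -/
def xbar (α β : ℝ) : ℝ := (1 + α) / (1 - β)

/-- The planar map of the equation: `(y, z) ↦ (z, α + β y + y / z)`. -/
def T (α β : ℝ) (q : ℝ × ℝ) : ℝ × ℝ := (q.2, α + β * q.1 + q.1 / q.2)

/-- The fixed point `(x̄, x̄)` of `T`. -/
def fixedPt (α β : ℝ) : ℝ × ℝ := (xbar α β, xbar α β)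

/-- The local stable manifold of `p` relative to `N`: the points of `N` whose forward orbit stays
in `N` and converges to `p`. -/
def localStableManifold (F : ℝ × ℝ → ℝ × ℝ) (p : ℝ × ℝ) (N : Set (ℝ × ℝ)) : Set (ℝ × ℝ) :=
  {q | q ∈ N ∧ (∀ n : ℕ, F^[n] q ∈ N) ∧ Tendsto (fun n : ℕ => F^[n] q) atTop (𝓝 p)}

def theta (α β : ℝ) : ℝ := √(1 + 4 * xbar α β + 4 * β * xbar α β ^ 2)

/-- The eigenvalue of the linearization of `T` at the fixed point outside the unit circle. -/
def lam1 (α β : ℝ) : ℝ := (-1 - theta α β) / (2 * xbar α β)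

/-- The eigenvalue of the linearization of `T` at the fixed point inside the unit circle. -/
def lam2 (α β : ℝ) : ℝ := (-1 + theta α β) / (2 * xbar α β)

/-- The point of the plane with eigencoordinates `(ξ, η)`, that is `(x̄, x̄) + ξ v₁ + η v₂` for the
eigenvectors `v₁ = (-2 x̄ / (1 + θ), 1)` and `v₂ = (-2 x̄ / (1 - θ), 1)`. -/
def eigenPt (α β ξ η : ℝ) : ℝ × ℝ :=
  (xbar α β + (-2 * xbar α β / (1 + theta α β) * ξ + -2 * xbar α β / (1 - theta α β) * η),
    xbar α β + (ξ + η))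

/-- The nonlinear part of the first component of `T` in eigencoordinates. -/
def f (α β ξ η : ℝ) : ℝ :=
  ((1 + 2 * β * xbar α β) * (ξ + η) ^ 2 + theta α β * (ξ ^ 2 - η ^ 2)) /
    (theta α β * (theta α β - 1) * (ξ + η + xbar α β))

/-- The nonlinear part of the second component of `T` in eigencoordinates. -/
def g (α β ξ η : ℝ) : ℝ :=
  ((1 + 2 * β * xbar α β) * (ξ + η) ^ 2 + theta α β * (ξ ^ 2 - η ^ 2)) /
    (theta α β * (theta α β + 1) * (ξ + η + xbar α β))

def gamma1 (α β : ℝ) : ℝ := (1 + β * xbar α β) / (-theta α β)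

def gamma2 (α β : ℝ) : ℝ := (theta α β - 1) / (2 * theta α β)

def gamma3 (α β : ℝ) : ℝ := (theta α β + 1) / (2 * theta α β)

def b2 (α β : ℝ) : ℝ :=
  (1 - theta α β + 2 * β * xbar α β) /
    (theta α β * (theta α β - 1) * (lam2 α β ^ 2 - lam1 α β) * xbar α β)

def b3 (α β : ℝ) : ℝ :=
  b2 α β / ((lam2 α β ^ 3 - lam1 α β) * xbar α β) *
    (lam1 α β - lam2 α β ^ 2
      + (1 + 2 * β * xbar α β) / (theta α β * xbar α β) *
          (1 / lam2 α β + lam2 α β / lam1 α β)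
      - lam2 α β / (lam1 α β * xbar α β))

/-- The cubic `S` whose zero set approximates the local stable manifold. -/
def S (α β x y : ℝ) : ℝ :=
  gamma1 α β * (x - xbar α β) + gamma3 α β * (y - xbar α β)
    - b2 α β * (gamma1 α β * (x - xbar α β) - gamma2 α β * (y - xbar α β)) ^ 2
    + b3 α β * (gamma1 α β * (x - xbar α β) - gamma2 α β * (y - xbar α β)) ^ 3

end SecondOrderEq

end

/-! The stable manifold is found among bounded sequences rather than in the plane (Irwin's method).
With denominators cleared, an orbit of `T` near the saddle is a small bounded sequence `u` of
deviations from `x̄` with `residual u = 0`, and `residual` is a quadratic polynomial map on the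
Banach algebra of bounded sequences. Its derivative at `0` is `x̄ (σ - λ₁)(σ - λ₂)`, with `σ` the
shift. As `|λ₁| > 1 > |λ₂|`, it is onto with kernel spanned by `λ₂ⁿ`. Adjoining a functional `ℓ`
nonzero on `λ₂ⁿ` gives an isomorphism (`bijective_secondOrder_prod`), so the small solutions form an
analytic curve parametrized by `ℓ` (`exists_analyticAt_curve_residual`). Taking for `ℓ` the
`η`-coordinate yields `ψ`; taking `u 1` yields `w`.

The shift of a solution is a solution, so by uniqueness the shift moves points along the curve. This
gives both convergence to the equilibrium and the invariance equation, which determines the Taylor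
coefficients of `ψ` (`isBigO_of_invariant_curve`). Finally `S (w y) y` is exactly the Taylor
remainder of `ψ` at the `η`-coordinate of `(w y, y)`, and `S` bounds horizontal distance to its zero
set (`isBigO_sub_of_S`). -/

/-! ### Tools: analytic zero curves and Neumann inversion -/

/-- If `(F', ℓ)` is an isomorphism at a zero `x₀` of `F`, the zeros of `F` near `x₀` form an
analytic curve parametrized by `ℓ`. -/
theorem exists_analyticAt_curve_of_bijective {E E' : Type*} [NormedAddCommGroup E]
    [NormedSpace ℝ E] [CompleteSpace E] [NormedAddCommGroup E'] [NormedSpace ℝ E']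
    [CompleteSpace E'] {F : E → E'} {F' : E →L[ℝ] E'} {ℓ : E →L[ℝ] ℝ} {x₀ : E}
    (hF : ContDiff ℝ ⊤ F) (hF' : HasFDerivAt F F' x₀) (h0 : F x₀ = 0)
    (hbij : Function.Bijective (F'.prod ℓ)) :
    ∃ h : ℝ → E, AnalyticAt ℝ h (ℓ x₀) ∧ h (ℓ x₀) = x₀ ∧
      (∀ᶠ t in 𝓝 (ℓ x₀), F (h t) = 0 ∧ ℓ (h t) = t) ∧
      (∀ᶠ x in 𝓝 x₀, F x = 0 → h (ℓ x) = x) := by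
  set G : E → E' × ℝ := fun x => (F x, ℓ x)
  set e : E ≃L[ℝ] E' × ℝ := ContinuousLinearEquiv.ofBijective (F'.prod ℓ)
    (LinearMap.ker_eq_bot.2 hbij.1) (LinearMap.range_eq_top.2 hbij.2)
  -- The exponent `⊤` means analytic, which is what makes the local inverse analytic below.
  have hG : ContDiffAt ℝ ⊤ G x₀ := (hF.prodMk ℓ.contDiff).contDiffAt
  have hG' : HasFDerivAt G (e : E →L[ℝ] E' × ℝ) x₀ := hF'.prodMk ℓ.hasFDerivAt
  have hs := hG.hasStrictFDerivAt' hG' (by simp)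
  set H := hs.localInverse G e x₀
  have hGx : G x₀ = (0, ℓ x₀) := by simp [G, h0]
  have hcurve : AnalyticAt ℝ (fun t : ℝ => ((0 : E'), t)) (ℓ x₀) :=
    analyticAt_const.prod analyticAt_id
  have hcont : Tendsto (fun t : ℝ => ((0 : E'), t)) (𝓝 (ℓ x₀)) (𝓝 (G x₀)) := by
    rw [hGx]; exact hcurve.continuousAt
  refine ⟨fun t => H (0, t), ?_, ?_, ?_, ?_⟩
  · have hH : AnalyticAt ℝ H (0, ℓ x₀) := by
      rw [← hGx]
      exact (hG.to_localInverse hG' (by simp)).analyticAt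
    exact hH.fun_comp hcurve
  · show H (0, ℓ x₀) = x₀
    rw [← hGx]
    exact hs.localInverse_apply_image
  · filter_upwards [hcont.eventually hs.eventually_right_inverse] with t ht
    exact ⟨congrArg Prod.fst ht, congrArg Prod.snd ht⟩
  · filter_upwards [hs.eventually_left_inverse] with x hx hFx
    have : G x = (0, ℓ x) := by simp [G, hFx]
    rwa [this] at hx

/-- Neumann series: factoring out `-l` leaves `1 - l⁻¹ A` with `‖l⁻¹ A‖ < 1`. -/
theorem bijective_sub_smul_id_of_norm_lt {E : Type*} [NormedAddCommGroup E] [NormedSpace ℝ E]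
    [CompleteSpace E] {A : E →L[ℝ] E} {l : ℝ} (hl : ‖A‖ < |l|) :
    Function.Bijective (A - l • ContinuousLinearMap.id ℝ E) := by
  have hl0 : l ≠ 0 := abs_pos.1 ((norm_nonneg A).trans_lt hl)
  have h : IsUnit (1 - l⁻¹ • A) := (Units.oneSub (l⁻¹ • A) (by
    rw [norm_smul, norm_inv, Real.norm_eq_abs]
    exact (inv_mul_lt_one₀ (abs_pos.2 hl0)).2 hl)).isUnit
  have h2 : A - l • ContinuousLinearMap.id ℝ E = Units.mk0 (-l) (neg_ne_zero.2 hl0) •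
      (1 - l⁻¹ • A) := by
    ext x
    simp [Units.smul_def, smul_smul, hl0, sub_eq_neg_add, add_comm]
  rw [h2]
  exact ContinuousLinearMap.isUnit_iff_bijective.1 (h.smul _)

/-! ### Linear recurrences on bounded sequences -/

namespace BoundedSeq

open BoundedContinuousFunction

/-- The left shift on bounded sequences. -/
noncomputable def shift : (ℕ →ᵇ ℝ) →L[ℝ] (ℕ →ᵇ ℝ) :=
  LinearMap.mkContinuous
    { toFun := fun u => u.compContinuous ⟨Nat.succ, continuous_of_discreteTopology⟩
      map_add' := fun _ _ => rfl
      map_smul' := fun _ _ => rfl }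
    1 fun u => by
      rw [one_mul]
      exact norm_compContinuous_le u _

@[simp]
theorem shift_apply (u : ℕ →ᵇ ℝ) (n : ℕ) : shift u n = u (n + 1) := rfl

theorem norm_shift_le : ‖shift‖ ≤ 1 :=
  shift.opNorm_le_bound zero_le_one fun u => by
    rw [one_mul]
    exact norm_compContinuous_le u _

/-- The geometric sequence of ratio `l`. -/
noncomputable def geom (l : ℝ) (hl : |l| < 1) : ℕ →ᵇ ℝ :=
  ofNormedAddCommGroup (fun n => l ^ n) continuous_of_discreteTopology 1 fun n => by
    simpa using pow_le_one₀ (abs_nonneg l) hl.le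

@[simp]
theorem geom_apply (l : ℝ) (hl : |l| < 1) (n : ℕ) : geom l hl n = l ^ n := rfl

theorem eq_smul_geom {l : ℝ} (hl : |l| < 1) {u : ℕ →ᵇ ℝ} (hu : ∀ n, u (n + 1) = l * u n) :
    u = u 0 • geom l hl := by
  ext n
  induction n with
  | zero => simp
  | succ n ih => rw [hu, ih]; simp [pow_succ]; ring

/-- For `|l| > 1` the operator `S - l` is bijective on bounded sequences. -/
theorem bijective_shift_sub_smul {l : ℝ} (hl : 1 < |l|) :
    Function.Bijective (shift - l • ContinuousLinearMap.id ℝ (ℕ →ᵇ ℝ)) :=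
  bijective_sub_smul_id_of_norm_lt (norm_shift_le.trans_lt hl)

/-- For `|l| < 1` the operator `S - l` is surjective on bounded sequences. -/
theorem surjective_shift_sub_smul {l : ℝ} (hl : |l| < 1) :
    Function.Surjective (shift - l • ContinuousLinearMap.id ℝ (ℕ →ᵇ ℝ)) := by
  intro v
  -- Solve forward from `0`; the bound `‖v‖ / (1 - |l|)` is the fixed point of `a ↦ |l| a + ‖v‖`.
  let u : ℕ → ℝ := fun n => Nat.rec 0 (fun k a => l * a + v k) n
  have hpos : 0 < 1 - |l| := by linarith
  have hu : ∀ n, ‖u n‖ ≤ ‖v‖ / (1 - |l|) := by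
    intro n
    induction n with
    | zero => simpa [u] using div_nonneg (norm_nonneg v) hpos.le
    | succ k ih =>
      calc ‖l * u k + v k‖ ≤ ‖l * u k‖ + ‖v k‖ := norm_add_le _ _
        _ ≤ |l| * (‖v‖ / (1 - |l|)) + ‖v‖ := by
          rw [norm_mul, Real.norm_eq_abs l]
          gcongr
          exact v.norm_coe_le_norm k
        _ = ‖v‖ / (1 - |l|) := by field_simp; ring
  refine ⟨ofNormedAddCommGroup u continuous_of_discreteTopology _ hu, ?_⟩
  ext n
  simp [u]

/-- A second order linear recurrence with one characteristic root outside the unit disc and one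
inside is uniquely solvable in bounded sequences, given a functional that does not vanish on the
decaying solution. -/
theorem bijective_secondOrder_prod {c l₁ l₂ : ℝ} (hc : c ≠ 0) (h1 : 1 < |l₁|) (h2 : |l₂| < 1)
    {L : (ℕ →ᵇ ℝ) →L[ℝ] (ℕ →ᵇ ℝ)} {ℓ : (ℕ →ᵇ ℝ) →L[ℝ] ℝ}
    (hL : ∀ u n, L u n = c * (u (n + 2) - (l₁ + l₂) * u (n + 1) + l₁ * l₂ * u n))
    (hℓ : ℓ (geom l₂ h2) ≠ 0) : Function.Bijective (L.prod ℓ) := by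
  have hfac : ∀ u, L u = c • (shift - l₁ • ContinuousLinearMap.id ℝ (ℕ →ᵇ ℝ))
      ((shift - l₂ • ContinuousLinearMap.id ℝ (ℕ →ᵇ ℝ)) u) := by
    intro u
    ext n
    simp only [hL, BoundedContinuousFunction.smul_apply, BoundedContinuousFunction.sub_apply,
      _root_.smul_apply, _root_.sub_apply, shift_apply, ContinuousLinearMap.id_apply, smul_eq_mul]
    ring
  have hker : L (geom l₂ h2) = 0 := by
    ext n; simp [hL, pow_succ]; right; ring
  constructor
  · rw [injective_iff_map_eq_zero]
    intro u hu
    have hLu : L u = 0 := congrArg Prod.fst hu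
    have hℓu : ℓ u = 0 := congrArg Prod.snd hu
    rw [hfac, smul_eq_zero_iff_right hc] at hLu
    have h := (injective_iff_map_eq_zero _).1 (bijective_shift_sub_smul h1).1 _ hLu
    have hug : u = u 0 • geom l₂ h2 := eq_smul_geom h2 fun n => by
      have := DFunLike.congr_fun h n
      simp at this
      linarith
    rw [hug, map_smul, smul_eq_mul, mul_eq_zero, or_iff_left hℓ] at hℓu
    rw [hug, hℓu, zero_smul]
  · rintro ⟨b, t⟩
    obtain ⟨v, hv⟩ := (bijective_shift_sub_smul h1).2 (c⁻¹ • b)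
    obtain ⟨u, hu⟩ := surjective_shift_sub_smul h2 v
    -- A multiple of the kernel element corrects the value of `ℓ` without changing `L u`.
    refine ⟨u + ((t - ℓ u) / ℓ (geom l₂ h2)) • geom l₂ h2, Prod.ext ?_ ?_⟩
    · simp [hker, hfac u, hu, hv, hc]
    · simp [hℓ]

end BoundedSeq

/-! ### The nonlinear recurrence and its curve of small solutions -/

namespace BoundedSeq

open BoundedContinuousFunction

/-- The linear part of `residual`. -/
noncomputable def linResidual (c b : ℝ) : (ℕ →ᵇ ℝ) →L[ℝ] (ℕ →ᵇ ℝ) :=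
  c • shift.comp shift + shift - (b * c + 1) • ContinuousLinearMap.id ℝ (ℕ →ᵇ ℝ)

/-- The defect of `c + u` as a solution of `x (n+2) x (n+1) = (α + β x n) x (n+1) + x n`, where
`c` is the equilibrium and `b` stands for `β`. -/
noncomputable def residual (c b : ℝ) (u : ℕ →ᵇ ℝ) : ℕ →ᵇ ℝ :=
  linResidual c b u + shift u * (shift (shift u) - b • u)

theorem linResidual_apply (c b : ℝ) (u : ℕ →ᵇ ℝ) (n : ℕ) :
    linResidual c b u n = c * u (n + 2) + u (n + 1) - (b * c + 1) * u n := rfl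

theorem residual_apply (c b : ℝ) (u : ℕ →ᵇ ℝ) (n : ℕ) :
    residual c b u n = c * u (n + 2) + u (n + 1) - (b * c + 1) * u n +
      u (n + 1) * (u (n + 2) - b * u n) := rfl

theorem residual_zero (c b : ℝ) : residual c b 0 = 0 := by
  simp [residual]

/-- The recurrence is autonomous, so shifting preserves solutions; with uniqueness, the shift acts
on the solution curve. -/
theorem residual_shift (c b : ℝ) (u : ℕ →ᵇ ℝ) :
    residual c b (shift u) = shift (residual c b u) := rfl

theorem contDiff_residual (c b : ℝ) : ContDiff ℝ ⊤ (residual c b) := by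
  unfold residual
  have h1 : ContDiff ℝ ⊤ (fun u : ℕ →ᵇ ℝ => shift u) := shift.contDiff
  have h2 : ContDiff ℝ ⊤ (fun u : ℕ →ᵇ ℝ => shift (shift u)) := shift.contDiff.comp h1
  exact (linResidual c b).contDiff.add (h1.mul (h2.sub (contDiff_id.const_smul b)))

theorem hasFDerivAt_residual (c b : ℝ) : HasFDerivAt (residual c b) (linResidual c b) 0 := by
  have h1 : HasFDerivAt (fun u : ℕ →ᵇ ℝ => shift u) shift 0 := shift.hasFDerivAt
  have h2 : HasFDerivAt (fun u : ℕ →ᵇ ℝ => shift (shift u) - b • u)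
      (shift.comp shift - b • ContinuousLinearMap.id ℝ (ℕ →ᵇ ℝ)) 0 :=
    (shift.comp shift - b • ContinuousLinearMap.id ℝ (ℕ →ᵇ ℝ)).hasFDerivAt
  have h3 := (linResidual c b).hasFDerivAt (x := 0) |>.add (h1.mul h2)
  refine h3.congr_fderiv ?_
  ext u n
  simp

section Curve

variable {c b l₁ l₂ : ℝ}

/-- The small bounded solutions of the recurrence form an analytic curve. -/
theorem exists_analyticAt_curve_residual (hc : c ≠ 0) (h1 : 1 < |l₁|) (h2 : |l₂| < 1)
    (hsum : c * (l₁ + l₂) = -1) (hprod : c * (l₁ * l₂) = -(b * c + 1))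
    {ℓ : (ℕ →ᵇ ℝ) →L[ℝ] ℝ} (hℓ : ℓ (geom l₂ h2) ≠ 0) :
    ∃ h : ℝ → (ℕ →ᵇ ℝ), AnalyticAt ℝ h 0 ∧ h 0 = 0 ∧
      HasDerivAt h ((ℓ (geom l₂ h2))⁻¹ • geom l₂ h2) 0 ∧
      (∀ᶠ t in 𝓝 0, residual c b (h t) = 0 ∧ ℓ (h t) = t) ∧
      (∀ᶠ u in 𝓝 0, residual c b u = 0 → h (ℓ u) = u) := by
  have hL : ∀ u n, linResidual c b u n =
      c * (u (n + 2) - (l₁ + l₂) * u (n + 1) + l₁ * l₂ * u n) := fun u n => by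
    rw [linResidual_apply]
    linear_combination u (n + 1) * hsum - u n * hprod
  have hbij := bijective_secondOrder_prod hc h1 h2 hL hℓ
  obtain ⟨h, han, h0, hsol, huniq⟩ := exists_analyticAt_curve_of_bijective
    (contDiff_residual c b) (hasFDerivAt_residual c b) (residual_zero c b) hbij
  rw [map_zero] at han h0 hsol
  refine ⟨h, han, h0, ?_, hsol, huniq⟩
  -- Differentiating `residual (h t) = 0` and `ℓ (h t) = t` at `0` determines the tangent vector, by
  -- injectivity of the linearization.
  have hd : HasDerivAt h (deriv h 0) 0 := han.differentiableAt.hasDerivAt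
  have e1 : linResidual c b (deriv h 0) = 0 := by
    have hr : HasFDerivAt (residual c b) (linResidual c b) (h 0) := h0 ▸ hasFDerivAt_residual c b
    refine (hr.comp_hasDerivAt 0 hd).unique ?_
    exact (hasDerivAt_const (0 : ℝ) (0 : ℕ →ᵇ ℝ)).congr_of_eventuallyEq
      (hsol.mono fun t ht => ht.1)
  have e2 : ℓ (deriv h 0) = 1 := by
    refine (ℓ.hasFDerivAt.comp_hasDerivAt 0 hd).unique ?_
    exact (hasDerivAt_id (0 : ℝ)).congr_of_eventuallyEq (hsol.mono fun t ht => ht.2)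
  have e3 : linResidual c b (geom l₂ h2) = 0 := by
    ext n
    simp only [hL, geom_apply, pow_succ, BoundedContinuousFunction.coe_zero, Pi.zero_apply]
    ring
  have : deriv h 0 = (ℓ (geom l₂ h2))⁻¹ • geom l₂ h2 :=
    hbij.1 (Prod.ext (e1.trans (by simp [e3])) (e2.trans (by simp [hℓ])))
  rwa [this] at hd

/-- Small bounded solutions of the recurrence converge to the equilibrium. -/
theorem eventually_tendsto_of_residual_eq_zero (hc : c ≠ 0) (h1 : 1 < |l₁|) (h2 : |l₂| < 1)
    (hsum : c * (l₁ + l₂) = -1) (hprod : c * (l₁ * l₂) = -(b * c + 1)) :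
    ∀ᶠ u in 𝓝 (0 : ℕ →ᵇ ℝ), residual c b u = 0 → Tendsto u atTop (𝓝 0) := by
  -- Parametrize by the initial term: `t ↦ h t 1` is then the one-step dynamics on the curve, with
  -- multiplier `l₂`.
  obtain ⟨h, han, h0, hd, hsol, huniq⟩ := exists_analyticAt_curve_residual hc h1 h2 hsum hprod
    (ℓ := evalCLM ℝ 0) (by simp)
  obtain ⟨q, hq2, hq1⟩ := exists_between h2
  have hφ : HasDerivAt (fun t => h t 1) l₂ 0 := by
    have := (evalCLM ℝ 1 : (ℕ →ᵇ ℝ) →L[ℝ] ℝ).hasFDerivAt.comp_hasDerivAt 0 hd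
    simpa [Function.comp_def] using this
  have hcontr : ∀ᶠ t in 𝓝 (0 : ℝ), |h t 1| ≤ q * |t| := by
    have := hφ.isLittleO.def (sub_pos.2 hq2)
    filter_upwards [this] with t ht
    simp only [h0, sub_zero, BoundedContinuousFunction.coe_zero, Pi.zero_apply, smul_eq_mul,
      Real.norm_eq_abs] at ht
    have h3 := abs_add_le (h t 1 - t * l₂) (t * l₂)
    rw [sub_add_cancel, abs_mul] at h3
    linarith
  have hshift : ∀ᶠ t in 𝓝 (0 : ℝ), residual c b (shift (h t)) = 0 →
      h (shift (h t) 0) = shift (h t) := by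
    have : Tendsto (fun t => shift (h t)) (𝓝 0) (𝓝 0) := by
      have h4 := (shift.continuous.continuousAt (x := h 0)).comp han.continuousAt
      unfold ContinuousAt at h4
      simpa [h0, Function.comp_def] using h4
    exact this.eventually huniq
  obtain ⟨r, hr, hball⟩ := Metric.eventually_nhds_iff.1 (hcontr.and (hshift.and hsol))
  have hq0 : 0 ≤ q := (abs_nonneg _).trans hq2.le
  have hdecay : ∀ n t, |t| < r → |h t n| ≤ q ^ n * |t| := by
    intro n
    induction n with
    | zero =>
      intro t ht
      have := (hball (y := t) (by simpa using ht)).2.2.2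
      simp only [evalCLM_apply] at this
      simp [this]
    | succ n ih =>
      intro t ht
      obtain ⟨k1, k2, k3, -⟩ := hball (y := t) (by simpa using ht)
      -- The tail of `h t` is the curve point with parameter `h t 1`, so the contraction can be
      -- iterated.
      have k4 := k2 (by rw [residual_shift, k3, map_zero])
      have k5 : h t (n + 1) = h (h t 1) n := by
        rw [← shift_apply, ← k4]; rfl
      rw [k5]
      refine (ih _ ?_).trans ?_
      · refine k1.trans_lt (lt_of_le_of_lt ?_ ht)
        exact mul_le_of_le_one_left (abs_nonneg t) hq1.le
      · calc q ^ n * |h t 1| ≤ q ^ n * (q * |t|) := by gcongr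
          _ = q ^ (n + 1) * |t| := by ring
  have hev0 : Tendsto (fun u : ℕ →ᵇ ℝ => |u 0|) (𝓝 0) (𝓝 0) := by
    have := ((evalCLM ℝ 0 : (ℕ →ᵇ ℝ) →L[ℝ] ℝ).continuous.abs).tendsto 0
    simpa using this
  filter_upwards [huniq, hev0.eventually (gt_mem_nhds hr)] with u hu hu0 hres
  have hu' : h (u 0) = u := hu hres
  refine squeeze_zero_norm (a := fun n => q ^ n * |u 0|) (fun n => ?_) ?_
  · have := hdecay n (u 0) hu0
    rwa [hu'] at this
  · simpa using (tendsto_pow_atTop_nhds_zero_of_lt_one hq0 hq1).mul_const |u 0|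

end Curve

end BoundedSeq

/-! ### Taylor coefficients of an invariant curve -/

theorem AnalyticAt.exists_eq_add_mul_add_sq_mul {ψ : ℝ → ℝ} (hψ : AnalyticAt ℝ ψ 0) :
    ∃ φ : ℝ → ℝ, AnalyticAt ℝ φ 0 ∧ ∀ t, ψ t = ψ 0 + deriv ψ 0 * t + t ^ 2 * φ t := by
  obtain ⟨p, hp⟩ := hψ
  refine ⟨dslope (dslope ψ 0) 0,
    ⟨_, hp.has_fpower_series_dslope_fslope.has_fpower_series_dslope_fslope⟩, fun t => ?_⟩
  have h1 := sub_smul_dslope ψ 0 t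
  have h2 := sub_smul_dslope (dslope ψ 0) 0 t
  rw [dslope_same] at h2
  simp only [sub_zero, smul_eq_mul] at h1 h2
  linear_combination (-1) * h1 - t * h2

/-- The quadratic and cubic Taylor coefficients of an analytic invariant curve tangent to the
`η`-axis, for a planar map whose nonlinear part is a quadratic form over an affine one. -/
theorem isBigO_of_invariant_curve {ψ : ℝ → ℝ} {A θ c l₁ l₂ k₁ k₂ : ℝ} (hc : c ≠ 0)
    (hψ : AnalyticAt ℝ ψ 0) (hψ0 : ψ 0 = 0) (hψ1 : HasDerivAt ψ 0 0)
    (hinv : ∀ᶠ η in 𝓝 (0 : ℝ),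
      ψ (l₂ * η + (A * (ψ η + η) ^ 2 + θ * (ψ η ^ 2 - η ^ 2)) / (k₂ * (ψ η + η + c))) =
        l₁ * ψ η + (A * (ψ η + η) ^ 2 + θ * (ψ η ^ 2 - η ^ 2)) / (k₁ * (ψ η + η + c))) :
    ∃ a b : ℝ, ((fun η => ψ η - (a * η ^ 2 + b * η ^ 3)) =O[𝓝 0] fun η => η ^ 4) ∧
      l₂ ^ 2 * a = l₁ * a + (A - θ) / c / k₁ ∧
      l₂ ^ 3 * b + 2 * l₂ * ((A - θ) / c / k₂) * a =
        l₁ * b + (2 * A * a * c - (A - θ)) / c ^ 2 / k₁ := by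
  obtain ⟨φ, hφ, hψφ⟩ := hψ.exists_eq_add_mul_add_sq_mul
  simp only [hψ0, hψ1.deriv, zero_mul, zero_add] at hψφ
  have hφ1 : HasDerivAt φ (deriv φ 0) 0 := hφ.differentiableAt.hasDerivAt
  refine ⟨φ 0, deriv φ 0, ?_, ?_⟩
  · obtain ⟨χ, hχ, hφχ⟩ := hφ.exists_eq_add_mul_add_sq_mul
    have h1 : (fun η => ψ η - (φ 0 * η ^ 2 + deriv φ 0 * η ^ 3)) = fun η => η ^ 4 * χ η := by
      ext η
      rw [hψφ, hφχ]
      ring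
    rw [h1]
    simpa using (isBigO_refl (fun η : ℝ => η ^ 4) (𝓝 0)).mul
      (hχ.continuousAt.norm.isBoundedUnder_le.isBigO_one ℝ)
  -- With `ψ η = η² φ η`, the quadratic form is `η² P η`, each nonlinear fraction is `η² R η / k`,
  -- and the argument of `ψ` on the left is `η * m η`. Division by `η²` leaves `m² φ(η m) = l₁ φ + R
  -- / k₁`.
  set P : ℝ → ℝ := fun η => (A - θ) + 2 * A * (η * φ η) + (A + θ) * (η * φ η) ^ 2 with hPdef
  set R : ℝ → ℝ := fun η => P η / (η * (η * φ η) + η + c) with hRdef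
  set m : ℝ → ℝ := fun η => l₂ + η * (R η / k₂) with hmdef
  have hηφ : HasDerivAt (fun η => η * φ η) (φ 0) 0 := by
    exact ((hasDerivAt_id' (0 : ℝ)).mul hφ1).congr_deriv (by simp)
  have hP : HasDerivAt P (2 * A * φ 0) 0 := by
    exact (((hηφ.const_mul (2 * A)).const_add (A - θ)).add
      ((hηφ.pow 2).const_mul (A + θ))).congr_deriv (by simp)
  have hD : HasDerivAt (fun η => η * (η * φ η) + η + c) 1 0 := by
    exact ((((hasDerivAt_id' (0 : ℝ)).mul hηφ).add (hasDerivAt_id' (0 : ℝ))).add_const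
      c).congr_deriv (by simp)
  have hP0 : P 0 = A - θ := by simp [hPdef]
  have hR0 : R 0 = (A - θ) / c := by simp [hRdef, hP0]
  have hR : HasDerivAt R ((2 * A * φ 0 * c - (A - θ)) / c ^ 2) 0 := by
    exact (hP.div hD (by simpa using hc)).congr_deriv (by simp [hP0])
  have hm0 : m 0 = l₂ := by simp [hmdef]
  have hm : HasDerivAt m ((A - θ) / c / k₂) 0 := by
    exact (((hasDerivAt_id' (0 : ℝ)).mul (hR.div_const k₂)).const_add l₂).congr_deriv
      (by simp [hR0])
  have hηm : HasDerivAt (fun η => η * m η) l₂ 0 := by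
    exact ((hasDerivAt_id' (0 : ℝ)).mul hm).congr_deriv (by simp [hm0])
  have hcomp : HasDerivAt (fun η => φ (η * m η)) (deriv φ 0 * l₂) 0 := by
    have h1 : HasDerivAt φ (deriv φ 0) (0 * m 0) := by rwa [zero_mul]
    exact h1.comp 0 hηm
  have hl := (hm.pow 2).mul hcomp
  have hr := (hφ1.const_mul l₁).add (hR.div_const k₁)
  have hne : (fun η => m η ^ 2 * φ (η * m η)) =ᶠ[𝓝[≠] 0] fun η => l₁ * φ η + R η / k₁ := by
    filter_upwards [hinv.filter_mono nhdsWithin_le_nhds, self_mem_nhdsWithin] with η hη hη0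
    have hη0 : η ≠ 0 := hη0
    have hk : ∀ k, (A * (ψ η + η) ^ 2 + θ * (ψ η ^ 2 - η ^ 2)) / (k * (ψ η + η + c)) =
        η ^ 2 * (R η / k) := by
      intro k
      have e1 : A * (ψ η + η) ^ 2 + θ * (ψ η ^ 2 - η ^ 2) = η ^ 2 * P η := by
        rw [hψφ, hPdef]; ring
      have e2 : ψ η + η + c = η * (η * φ η) + η + c := by rw [hψφ]; ring
      rw [e1, e2, hRdef, mul_comm k, ← div_div, mul_div_assoc, mul_div_assoc]
    have e3 : l₂ * η + η ^ 2 * (R η / k₂) = η * m η := by rw [hmdef]; ring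
    rw [hk, hk, e3, hψφ (η * m η), hψφ η] at hη
    have := pow_ne_zero 2 hη0
    apply mul_left_cancel₀ this
    linear_combination hη
  -- Continuity extends the divided equation to `η = 0`. Its values there give the relation for `a`,
  -- its derivatives the one for `b`.
  have heq := (hl.continuousAt.eventuallyEq_nhds_iff_eventuallyEq_nhdsNE hr.continuousAt).1 hne
  constructor
  · have := heq.eq_of_nhds
    simpa [hm0, hR0] using this
  · have := hl.unique (hr.congr_of_eventuallyEq heq)
    simp only [Pi.pow_apply, hm0, zero_mul] at this
    linear_combination this

/-! ### Eigenvalues and the coefficients `b2`, `b3` -/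

namespace SecondOrderEq

variable {α β : ℝ}

theorem one_le_xbar (hα0 : 0 ≤ α) (hβ0 : 0 ≤ β) (hβ1 : β < 1) : 1 ≤ xbar α β := by
  rw [xbar, le_div_iff₀ (by linarith)]
  linarith

theorem theta_sq (hβ0 : 0 ≤ β) (hX : 1 ≤ xbar α β) :
    theta α β ^ 2 = 1 + 4 * xbar α β + 4 * β * xbar α β ^ 2 :=
  Real.sq_sqrt (by positivity)

theorem one_lt_theta (hβ0 : 0 ≤ β) (hX : 1 ≤ xbar α β) : 1 < theta α β := by
  rw [theta, Real.lt_sqrt zero_le_one]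
  have : 0 ≤ 4 * β * xbar α β ^ 2 := by positivity
  linarith

theorem xbar_mul_lam_add (hX : 1 ≤ xbar α β) :
    xbar α β * (lam1 α β + lam2 α β) = -1 := by
  have : xbar α β ≠ 0 := by positivity
  rw [lam1, lam2]
  field_simp
  ring

theorem xbar_mul_lam_mul (hβ0 : 0 ≤ β) (hX : 1 ≤ xbar α β) :
    xbar α β * (lam1 α β * lam2 α β) = -(β * xbar α β + 1) := by
  have : xbar α β ≠ 0 := by positivity
  rw [lam1, lam2]
  field_simp
  linear_combination -theta_sq hβ0 hX

theorem lam2_pos (hβ0 : 0 ≤ β) (hX : 1 ≤ xbar α β) : 0 < lam2 α β :=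
  div_pos (by linarith [one_lt_theta hβ0 hX]) (by positivity)

theorem lam2_lt_one (hα0 : 0 ≤ α) (hβ0 : 0 ≤ β) (hβ1 : β < 1) : lam2 α β < 1 := by
  have hX := one_le_xbar hα0 hβ0 hβ1
  rw [lam2, div_lt_one (by positivity)]
  have : theta α β < 2 * xbar α β + 1 := by
    refine lt_of_pow_lt_pow_left₀ 2 (by positivity) ?_
    rw [theta_sq hβ0 hX]
    have : 0 < (1 - β) * xbar α β ^ 2 := mul_pos (by linarith) (by positivity)
    linarith
  linarith

theorem lam1_lt_neg_one (hα0 : 0 ≤ α) (hα1 : α < 1) (hβ0 : 0 ≤ β) (hβ1 : β < 1) :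
    lam1 α β < -1 := by
  have hX := one_le_xbar hα0 hβ0 hβ1
  rw [lam1, div_lt_iff₀ (by positivity)]
  -- After squaring this becomes `(1 - β) x̄ = 1 + α < 2`; here `α < 1` makes the fixed point a
  -- saddle.
  have : 2 * xbar α β - 1 < theta α β := by
    refine lt_of_pow_lt_pow_left₀ 2 (Real.sqrt_nonneg _) ?_
    rw [theta_sq hβ0 hX]
    have h1 : (1 - β) * xbar α β = 1 + α := by
      rw [xbar]; field_simp [(by linarith : 1 - β ≠ 0)]
    have h2 : (1 - β) * xbar α β ^ 2 = (1 + α) * xbar α β := by rw [← h1]; ring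
    have h3 : 0 < (1 - α) * xbar α β := mul_pos (by linarith) (by positivity)
    linarith
  linarith

/-- The solution `ψ` of the invariance equation has Taylor coefficients `b2` and `b3`. -/
theorem isBigO_sub_b2_b3 (hβ0 : 0 ≤ β) (hX : 1 ≤ xbar α β) (h1 : lam1 α β < -1) {ψ : ℝ → ℝ}
    (hψ : AnalyticAt ℝ ψ 0) (hψ0 : ψ 0 = 0) (hψ1 : HasDerivAt ψ 0 0)
    (hinv : ∀ᶠ η in 𝓝 (0 : ℝ), ψ (lam2 α β * η + g α β (ψ η) η) =
      lam1 α β * ψ η + f α β (ψ η) η) :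
    (fun η => ψ η - (b2 α β * η ^ 2 + b3 α β * η ^ 3)) =O[𝓝 0] fun η => η ^ 4 := by
  have hX0 : xbar α β ≠ 0 := by positivity
  obtain ⟨a, b, hO, ha, hb⟩ := isBigO_of_invariant_curve hX0 hψ hψ0 hψ1 hinv
  have hθ1 := one_lt_theta hβ0 hX
  have hθ : theta α β ≠ 0 := by positivity
  have hθm : theta α β - 1 ≠ 0 := by linarith
  have hθp : theta α β + 1 ≠ 0 := by positivity
  have hl2 := lam2_pos hβ0 hX
  have hd2 : lam2 α β ^ 2 - lam1 α β ≠ 0 := by nlinarith [sq_nonneg (lam2 α β)]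
  have hd3 : lam2 α β ^ 3 - lam1 α β ≠ 0 := by nlinarith [pow_pos hl2 3]
  have hl1 : lam1 α β ≠ 0 := by linarith
  have e1 : theta α β - 1 = 2 * xbar α β * lam2 α β := by rw [lam2]; field_simp; ring
  have e2 : theta α β + 1 = -(2 * xbar α β * lam1 α β) := by rw [lam1]; field_simp; ring
  have ha' : a = b2 α β := by
    rw [b2, eq_div_iff (by positivity)]
    field_simp at ha
    linear_combination ha
  have hb' : b = b3 α β := by
    have h2 : (lam2 α β ^ 2 - lam1 α β) * a * (xbar α β * (theta α β * (theta α β - 1))) =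
        1 + 2 * β * xbar α β - theta α β := by
      field_simp at ha
      linear_combination ha
    -- The equation for `a` replaces the one term free of `a`, so the right side acquires the factor
    -- `a` that appears in `b3`.
    have h3 : (lam2 α β ^ 3 - lam1 α β) * b = (2 * (1 + 2 * β * xbar α β) * a * xbar α β -
          (lam2 α β ^ 2 - lam1 α β) * a * (xbar α β * (theta α β * (theta α β - 1)))) /
            xbar α β ^ 2 / (theta α β * (theta α β - 1)) -
        2 * lam2 α β * ((1 + 2 * β * xbar α β - theta α β) / xbar α β /
          (theta α β * (theta α β + 1))) * a := by
      rw [h2]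
      linear_combination hb
    rw [b3, ← ha', ← mul_right_inj' hd3, h3, e1, e2]
    field_simp
    ring
  rwa [← ha', ← hb']

end SecondOrderEq

/-! ### Eigencoordinates, and orbits as bounded sequences -/

namespace SecondOrderEq

open BoundedSeq BoundedContinuousFunction

variable {α β : ℝ}

/-- The `ξ`-coordinate of `(x̄ + u, x̄ + v)`. -/
noncomputable def xiCoord (α β u v : ℝ) : ℝ := gamma1 α β * u + gamma3 α β * v

/-- The `η`-coordinate of `(x̄ + u, x̄ + v)`. -/
noncomputable def etaCoord (α β u v : ℝ) : ℝ := -gamma1 α β * u + gamma2 α β * v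

theorem eigenPt_xiCoord_etaCoord (hβ0 : 0 ≤ β) (hX : 1 ≤ xbar α β) (u v : ℝ) :
    eigenPt α β (xiCoord α β u v) (etaCoord α β u v) = (xbar α β + u, xbar α β + v) := by
  have hθ1 := one_lt_theta hβ0 hX
  have hθ : theta α β ≠ 0 := by positivity
  have hθm : 1 - theta α β ≠ 0 := by linarith
  have hθp : 1 + theta α β ≠ 0 := by positivity
  have hθ2 := theta_sq hβ0 hX
  rw [eigenPt, xiCoord, etaCoord, gamma1, gamma2, gamma3]
  refine Prod.ext ?_ ?_
  · show _ = xbar α β + u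
    field_simp
    linear_combination (u * theta α β) * hθ2
  · show _ = xbar α β + v
    field_simp
    ring

/-- The bracket in `S` is `-η`, hence the opposite signs before `b2` and `b3`; `S = 0` is the cubic
truncation of `ξ = ψ η`. -/
theorem S_xbar_add (u v : ℝ) : S α β (xbar α β + u) (xbar α β + v) =
    xiCoord α β u v - (b2 α β * etaCoord α β u v ^ 2 + b3 α β * etaCoord α β u v ^ 3) := by
  rw [S, xiCoord, etaCoord]
  ring

/-- The map `T` in eigencoordinates. -/
theorem coord_of_recurrence (hβ0 : 0 ≤ β) (hX : 1 ≤ xbar α β) {u v w : ℝ}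
    (hv : xbar α β + v ≠ 0)
    (h : xbar α β * w + v - (β * xbar α β + 1) * u + v * (w - β * u) = 0) :
    xiCoord α β v w = lam1 α β * xiCoord α β u v +
        f α β (xiCoord α β u v) (etaCoord α β u v) ∧
      etaCoord α β v w = lam2 α β * etaCoord α β u v +
        g α β (xiCoord α β u v) (etaCoord α β u v) := by
  have hX0 : xbar α β ≠ 0 := by positivity
  have hθ1 := one_lt_theta hβ0 hX
  have hθ : theta α β ≠ 0 := by positivity
  have hθm : theta α β - 1 ≠ 0 := by linarith
  have hθp : theta α β + 1 ≠ 0 := by positivity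
  have hθ2 := theta_sq hβ0 hX
  have hsum : xiCoord α β u v + etaCoord α β u v = v := by
    rw [xiCoord, etaCoord, gamma2, gamma3]; field_simp; ring
  have hdiff : theta α β * (xiCoord α β u v - etaCoord α β u v) =
      v - 2 * (1 + β * xbar α β) * u := by
    rw [xiCoord, etaCoord, gamma1, gamma2, gamma3]; field_simp; ring
  have hnum : (1 + 2 * β * xbar α β) * (xiCoord α β u v + etaCoord α β u v) ^ 2 +
      theta α β * (xiCoord α β u v ^ 2 - etaCoord α β u v ^ 2) =
      2 * (1 + β * xbar α β) * (v * (v - u)) := by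
    calc _ = (1 + 2 * β * xbar α β) * (xiCoord α β u v + etaCoord α β u v) ^ 2 +
          (xiCoord α β u v + etaCoord α β u v) *
            (theta α β * (xiCoord α β u v - etaCoord α β u v)) := by ring
      _ = _ := by rw [hdiff, hsum]; ring
  have hw : w = ((β * xbar α β + 1) * u - v + β * u * v) / (xbar α β + v) := by
    rw [eq_div_iff hv]; linear_combination h
  have hv' : v + xbar α β ≠ 0 := by rwa [add_comm]
  -- Since `θ² - 1 = 4 x̄ (1 + β x̄)`, a factor `θ ∓ 1` below trades for `θ ± 1` above.
  have hf : ∀ z, 2 * (1 + β * xbar α β) * z / (theta α β * (theta α β - 1) * (v + xbar α β)) =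
      (theta α β + 1) * z / (2 * theta α β * xbar α β * (v + xbar α β)) := fun z => by
    rw [div_eq_div_iff (by positivity) (by positivity)]
    linear_combination (-theta α β * z * (v + xbar α β)) * hθ2
  have hg : ∀ z, 2 * (1 + β * xbar α β) * z / (theta α β * (theta α β + 1) * (v + xbar α β)) =
      (theta α β - 1) * z / (2 * theta α β * xbar α β * (v + xbar α β)) := fun z => by
    rw [div_eq_div_iff (by positivity) (by positivity)]
    linear_combination (-theta α β * z * (v + xbar α β)) * hθ2
  rw [f, g, hnum, hsum, hf, hg, hw, add_comm (xbar α β) v, xiCoord, xiCoord, etaCoord, etaCoord, lam1,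
    lam2, gamma1, gamma2, gamma3]
  constructor
  · field_simp
    linear_combination (v * (xbar α β + v)) * hθ2
  · field_simp
    linear_combination (-v * (xbar α β + v)) * hθ2

/-- A nonvanishing bounded solution of the recurrence is an orbit of `T`. -/
theorem iterate_T_of_residual_eq_zero (hX : xbar α β * (1 - β) = 1 + α) {u : ℕ →ᵇ ℝ}
    (hu : residual (xbar α β) β u = 0) (hne : ∀ n, xbar α β + u n ≠ 0) (n : ℕ) :
    (T α β)^[n] (xbar α β + u 0, xbar α β + u 1) = (xbar α β + u n, xbar α β + u (n + 1)) := by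
  induction n with
  | zero => rfl
  | succ n ih =>
    rw [Function.iterate_succ_apply', ih, T]
    have h := DFunLike.congr_fun hu n
    rw [residual_apply, BoundedContinuousFunction.coe_zero, Pi.zero_apply] at h
    refine Prod.ext rfl ?_
    show α + β * (xbar α β + u n) + (xbar α β + u n) / (xbar α β + u (n + 1)) = _
    have := hne (n + 1)
    field_simp
    linear_combination (-1) * h - (xbar α β + u (n + 1)) * hX

/-- Conversely, an orbit of `T` in a small neighbourhood of the fixed point is a small bounded
solution of the recurrence. -/
theorem exists_residual_eq_zero_of_orbit (hX : xbar α β * (1 - β) = 1 + α) {r : ℝ}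
    (hr : 0 ≤ r) {q : ℝ × ℝ} (hpos : ∀ n, ((T α β)^[n] q).1 ≠ 0)
    (hq : ∀ n, dist ((T α β)^[n] q) (fixedPt α β) ≤ r) :
    ∃ u : ℕ →ᵇ ℝ, ‖u‖ ≤ r ∧ residual (xbar α β) β u = 0 ∧
      q = (xbar α β + u 0, xbar α β + u 1) := by
  have hbound : ∀ n, ‖((T α β)^[n] q).1 - xbar α β‖ ≤ r := fun n =>
    (le_max_left _ _).trans (hq n)
  set u : ℕ →ᵇ ℝ := ofNormedAddCommGroup (fun n => ((T α β)^[n] q).1 - xbar α β)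
    continuous_of_discreteTopology r hbound with hu
  have hu_apply : ∀ n, u n = ((T α β)^[n] q).1 - xbar α β := fun n => rfl
  have hsnd : ∀ n, xbar α β + u (n + 1) = ((T α β)^[n] q).2 := fun n => by
    rw [hu_apply, Function.iterate_succ_apply', T]
    ring
  refine ⟨u, (norm_le hr).2 hbound, ?_, Prod.ext ?_ ?_⟩
  · ext n
    have h1 : xbar α β + u n = ((T α β)^[n] q).1 := by rw [hu_apply]; ring
    have h3 : xbar α β + u (n + 2) = α + β * (xbar α β + u n) +
        (xbar α β + u n) / (xbar α β + u (n + 1)) := by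
      rw [hsnd (n + 1), h1, hsnd n, Function.iterate_succ_apply', T]
    have h2 : xbar α β + u (n + 1) ≠ 0 := by
      rw [hu_apply]; simpa using hpos (n + 1)
    rw [residual_apply, BoundedContinuousFunction.coe_zero, Pi.zero_apply]
    field_simp at h3
    linear_combination h3 - (xbar α β + u (n + 1)) * hX
  · rw [hu_apply]; simp
  · rw [hsnd]; rfl

/-- The sup norm controls all terms at once, so smallness of `u` confines the whole orbit. -/
theorem eventually_forall_mem (X : ℝ) {N : Set (ℝ × ℝ)} (hN : N ∈ 𝓝 (X, X)) :
    ∀ᶠ u in 𝓝 (0 : ℕ →ᵇ ℝ), ∀ n, (X + u n, X + u (n + 1)) ∈ N := by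
  obtain ⟨ε, hε, hball⟩ := Metric.mem_nhds_iff.1 hN
  filter_upwards [Metric.ball_mem_nhds (0 : ℕ →ᵇ ℝ) hε] with u hu n
  apply hball
  have h : ∀ k, |u k| < ε := fun k =>
    (u.norm_coe_le_norm k).trans_lt (by simpa using hu)
  rw [Metric.mem_ball, Prod.dist_eq, max_lt_iff]
  simpa [Real.dist_eq] using ⟨h n, h (n + 1)⟩

/-- Small bounded solutions of the recurrence lie in the local stable manifold. -/
theorem eventually_mem_localStableManifold (hX : xbar α β * (1 - β) = 1 + α)
    (hX1 : 1 ≤ xbar α β)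
    (hconv : ∀ᶠ u in 𝓝 (0 : ℕ →ᵇ ℝ), residual (xbar α β) β u = 0 → Tendsto u atTop (𝓝 0))
    {N : Set (ℝ × ℝ)} (hN : N ∈ 𝓝 (fixedPt α β)) :
    ∀ᶠ u in 𝓝 (0 : ℕ →ᵇ ℝ), residual (xbar α β) β u = 0 →
      (xbar α β + u 0, xbar α β + u 1) ∈
        localStableManifold (T α β) (fixedPt α β) N := by
  have hX0 : 0 < xbar α β := by positivity
  have hne : {q : ℝ × ℝ | 0 < q.1} ∈ 𝓝 (xbar α β, xbar α β) :=
    (isOpen_lt continuous_const continuous_fst).mem_nhds hX0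
  filter_upwards [hconv, eventually_forall_mem _ hN, eventually_forall_mem _ hne] with u h1 h2 h3 hu
  have horb := iterate_T_of_residual_eq_zero hX hu fun n => (h3 n).ne'
  refine ⟨h2 0, fun n => ?_, ?_⟩
  · rw [horb]; exact h2 n
  · simp only [horb]
    have hlim := h1 hu
    have h4 : Tendsto (fun n => xbar α β + u n) atTop (𝓝 (xbar α β)) := by
      simpa using hlim.const_add (xbar α β)
    exact h4.prodMk_nhds (h4.comp (tendsto_add_atTop_nat 1))

/-- All points of the local stable manifold in a small neighbourhood come from small bounded
solutions of the recurrence. -/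
theorem exists_nhds_localStableManifold (hX : xbar α β * (1 - β) = 1 + α)
    (hX1 : 1 ≤ xbar α β) {p : (ℕ →ᵇ ℝ) → Prop}
    (hp : ∀ᶠ u in 𝓝 (0 : ℕ →ᵇ ℝ), residual (xbar α β) β u = 0 → p u) :
    ∃ N₀ ∈ 𝓝 (fixedPt α β), (∀ q ∈ N₀, 0 < q.1 ∧ 0 < q.2) ∧
      ∀ N ⊆ N₀, ∀ q ∈ localStableManifold (T α β) (fixedPt α β) N,
        ∃ u, p u ∧ q = (xbar α β + u 0, xbar α β + u 1) := by
  obtain ⟨r, hr, hball⟩ := Metric.eventually_nhds_iff.1 hp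
  have hpos : {q : ℝ × ℝ | 0 < q.1 ∧ 0 < q.2} ∈ 𝓝 (fixedPt α β) := by
    have hX0 : 0 < xbar α β := by positivity
    exact ((isOpen_lt continuous_const continuous_fst).inter
      (isOpen_lt continuous_const continuous_snd)).mem_nhds ⟨hX0, hX0⟩
  -- The radius is halved because the sup norm of an orbit in the ball is only bounded weakly.
  -- Positivity keeps the map's denominators nonzero.
  refine ⟨{q | 0 < q.1 ∧ 0 < q.2} ∩ Metric.ball (fixedPt α β) (r / 2),
    inter_mem hpos (Metric.ball_mem_nhds _ (half_pos hr)), fun q hq => hq.1, ?_⟩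
  rintro N hN q ⟨-, hq, -⟩
  obtain ⟨u, hu1, hu2, hu3⟩ := exists_residual_eq_zero_of_orbit hX (half_pos hr).le
    (fun n => (hN (hq n)).1.1.ne') (fun n => (hN (hq n)).2.le)
  refine ⟨u, hball ?_ hu2, hu3⟩
  rw [dist_zero_right]
  linarith

end SecondOrderEq

/-! ### The zero set of `S` -/

namespace SecondOrderEq

open BoundedSeq BoundedContinuousFunction

variable {α β : ℝ}

/-- The functional `u ↦ a u₀ + b u₁` on bounded sequences. -/
noncomputable def initialFunctional (a b : ℝ) : (ℕ →ᵇ ℝ) →L[ℝ] ℝ :=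
  a • evalCLM ℝ 0 + b • evalCLM ℝ 1

@[simp]
theorem initialFunctional_apply (a b : ℝ) (u : ℕ →ᵇ ℝ) :
    initialFunctional a b u = a * u 0 + b * u 1 := rfl

/-- Near the fixed point the zero set of `S` is a graph over the second coordinate. -/
theorem exists_graph_S (hβ0 : 0 ≤ β) (hX : 1 ≤ xbar α β) :
    ∃ ψt : ℝ → ℝ,
      (∀ᶠ q in 𝓝 (fixedPt α β), S α β q.1 q.2 = 0 ↔ q.1 = ψt q.2) ∧
      (∀ᶠ y in 𝓝 (xbar α β), S α β (ψt y) y = 0) ∧ ψt (xbar α β) = xbar α β ∧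
      HasDerivAt ψt (2 * xbar α β / (theta α β - 1)) (xbar α β) := by
  have hθ1 := one_lt_theta hβ0 hX
  have hθ : theta α β ≠ 0 := by positivity
  have hθm : theta α β - 1 ≠ 0 := by linarith
  have hθ2 := theta_sq hβ0 hX
  have hγ : gamma1 α β ≠ 0 := div_ne_zero (by positivity) (neg_ne_zero.2 hθ)
  have hS : ContDiff ℝ ⊤ fun q : ℝ × ℝ => S α β q.1 q.2 := by
    unfold S; fun_prop
  have hS' : HasFDerivAt (fun q : ℝ × ℝ => S α β q.1 q.2)
      (gamma1 α β • ContinuousLinearMap.fst ℝ ℝ ℝ + gamma3 α β • ContinuousLinearMap.snd ℝ ℝ ℝ)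
      (fixedPt α β) := by
    have hx := (hasFDerivAt_fst (𝕜 := ℝ) (p := fixedPt α β)).sub_const (xbar α β)
    have hy := (hasFDerivAt_snd (𝕜 := ℝ) (p := fixedPt α β)).sub_const (xbar α β)
    have hd := (hx.const_mul (gamma1 α β)).sub (hy.const_mul (gamma2 α β))
    refine ((((hx.const_mul (gamma1 α β)).add (hy.const_mul (gamma3 α β))).sub
      ((hd.pow 2).const_mul (b2 α β))).add ((hd.pow 3).const_mul (b3 α β))).congr_fderiv ?_
    ext <;> simp [fixedPt]
  have hS0 : S α β (fixedPt α β).1 (fixedPt α β).2 = 0 := by simp [S, fixedPt]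
  obtain ⟨h, han, h0, hsol, huniq⟩ := exists_analyticAt_curve_of_bijective
    (ℓ := ContinuousLinearMap.snd ℝ ℝ ℝ) hS hS' hS0 (by
      constructor
      · rw [injective_iff_map_eq_zero]
        rintro ⟨x, y⟩ hxy
        simp only [ContinuousLinearMap.prod_apply, Prod.mk_eq_zero] at hxy
        have hy : y = 0 := hxy.2
        subst hy
        simpa [hγ] using hxy.1
      · rintro ⟨s, y⟩
        refine ⟨((s - gamma3 α β * y) / gamma1 α β, y), Prod.ext ?_ rfl⟩
        simp
        field_simp
        ring)
  have hsnd : ContinuousLinearMap.snd ℝ ℝ ℝ (fixedPt α β) = xbar α β := rfl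
  rw [hsnd] at han h0 hsol
  have hsolS : ∀ᶠ y in 𝓝 (xbar α β), S α β (h y).1 y = 0 := by
    filter_upwards [hsol] with y hy
    have h2 : (h y).2 = y := hy.2
    simpa only [h2] using hy.1
  have hd : HasDerivAt (fun y => (h y).1) (deriv (fun y => (h y).1) (xbar α β)) (xbar α β) :=
    (analyticAt_fst.fun_comp han).differentiableAt.hasDerivAt
  have hderiv : deriv (fun y => (h y).1) (xbar α β) = 2 * xbar α β / (theta α β - 1) := by
    have h1 : HasDerivAt (fun y => S α β (h y).1 y)
        (gamma1 α β * deriv (fun y => (h y).1) (xbar α β) + gamma3 α β) (xbar α β) := by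
      have h2 : HasFDerivAt (fun q : ℝ × ℝ => S α β q.1 q.2)
          (gamma1 α β • ContinuousLinearMap.fst ℝ ℝ ℝ +
            gamma3 α β • ContinuousLinearMap.snd ℝ ℝ ℝ) ((h (xbar α β)).1, xbar α β) := by
        rw [h0]; exact hS'
      refine (h2.comp_hasDerivAt (f := fun y => ((h y).1, y)) (xbar α β)
        (hd.prodMk (hasDerivAt_id' _))).congr_deriv ?_
      simp
    have h3 := h1.unique ((hasDerivAt_const (xbar α β) (0 : ℝ)).congr_of_eventuallyEq hsolS)
    have hB : 1 + β * xbar α β ≠ 0 := by positivity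
    rw [gamma1, gamma3] at h3
    field_simp at h3
    rw [eq_div_iff hθm, ← mul_right_inj' hB]
    linear_combination -(theta α β - 1) / 2 * h3 + hθ2 / 2
  rw [hderiv] at hd
  refine ⟨fun y => (h y).1, ?_, hsolS, congrArg Prod.fst h0, hd⟩
  have hy : Tendsto (fun q : ℝ × ℝ => q.2) (𝓝 (fixedPt α β)) (𝓝 (xbar α β)) :=
    continuous_snd.tendsto _
  filter_upwards [huniq, hy.eventually hsolS] with q h1 h2
  refine ⟨fun hq => ?_, fun hq => by rw [hq]; exact h2⟩
  exact (congrArg Prod.fst (h1 hq)).symm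

/-- Near the fixed point `S` controls the distance of two points on a horizontal line. -/
theorem isBigO_sub_of_S (hβ0 : 0 ≤ β) (hX : 1 ≤ xbar α β) {w v : ℝ → ℝ}
    (hw : ContinuousAt w (xbar α β)) (hv : ContinuousAt v (xbar α β))
    (hw0 : w (xbar α β) = xbar α β) (hv0 : v (xbar α β) = xbar α β)
    (hS : ∀ᶠ y in 𝓝 (xbar α β), S α β (v y) y = 0) :
    (fun y => w y - v y) =O[𝓝 (xbar α β)] fun y => S α β (w y) y := by
  have hθ1 := one_lt_theta hβ0 hX
  have hγ : gamma1 α β ≠ 0 := div_ne_zero (by positivity) (neg_ne_zero.2 (by positivity))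
  set s : (ℝ → ℝ) → ℝ → ℝ := fun w y =>
    gamma1 α β * (w y - xbar α β) - gamma2 α β * (y - xbar α β) with hs
  -- `K` is the divided difference of `S` in its first variable: `S (w y) y - S (v y) y = K y * (w y
  -- - v y)`, and `K` equals `γ₁ ≠ 0` at `x̄`.
  set K : ℝ → ℝ := fun y => gamma1 α β * (1 - b2 α β * (s w y + s v y) +
    b3 α β * (s w y ^ 2 + s w y * s v y + s v y ^ 2)) with hK
  have hKc : ContinuousAt K (xbar α β) := by
    simp only [hK, hs]; fun_prop
  have hK0 : K (xbar α β) = gamma1 α β := by simp [hK, hs, hw0, hv0]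
  have hKinv : (fun y => (K y)⁻¹) =O[𝓝 (xbar α β)] fun _ => (1 : ℝ) :=
    (hKc.inv₀ (by rwa [hK0])).norm.isBoundedUnder_le.isBigO_one ℝ
  have hmul := hKinv.mul (isBigO_refl (fun y => S α β (w y) y) (𝓝 (xbar α β)))
  simp only [one_mul] at hmul
  refine EventuallyEq.trans_isBigO ?_ hmul
  filter_upwards [hS, hKc.eventually_ne (by rwa [hK0])] with y hy hKy
  rw [eq_inv_mul_iff_mul_eq₀ hKy, ← sub_zero (S α β (w y) y), ← hy]
  simp only [hK, hs, S]
  ring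

end SecondOrderEq

/-! ### Assembly -/

open SecondOrderEq BoundedSeq BoundedContinuousFunction in
theorem theorem5 (α β : ℝ) (hα0 : 0 ≤ α) (hα1 : α < 1) (hβ0 : 0 ≤ β) (hβ1 : β < 1) :
    ∃ (ψ w ψt : ℝ → ℝ) (N₀ : Set (ℝ × ℝ)),
      N₀ ∈ 𝓝 (SecondOrderEq.fixedPt α β) ∧
      (∀ q ∈ N₀, 0 < q.1 ∧ 0 < q.2) ∧
      -- in eigencoordinates the local stable manifold is the graph `ξ = ψ η` of an analytic map
      AnalyticAt ℝ ψ 0 ∧ ψ 0 = 0 ∧ HasDerivAt ψ 0 0 ∧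
      (∀ N ∈ 𝓝 (SecondOrderEq.fixedPt α β), N ⊆ N₀ →
        (∀ q ∈ SecondOrderEq.localStableManifold (SecondOrderEq.T α β)
            (SecondOrderEq.fixedPt α β) N,
          ∃ η : ℝ, q = SecondOrderEq.eigenPt α β (ψ η) η) ∧
        (∀ᶠ η in 𝓝 (0 : ℝ), SecondOrderEq.eigenPt α β (ψ η) η ∈
          SecondOrderEq.localStableManifold (SecondOrderEq.T α β)
            (SecondOrderEq.fixedPt α β) N)) ∧
      -- the invariance equation, and the Taylor coefficients `b2` and `b3` of its solution `ψ`
      (∀ᶠ η in 𝓝 (0 : ℝ),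
        ψ (SecondOrderEq.lam2 α β * η + SecondOrderEq.g α β (ψ η) η) =
          SecondOrderEq.lam1 α β * ψ η + SecondOrderEq.f α β (ψ η) η) ∧
      (fun η : ℝ => ψ η - (SecondOrderEq.b2 α β * η ^ 2 + SecondOrderEq.b3 α β * η ^ 3))
        =O[𝓝 0] (fun η : ℝ => η ^ 4) ∧
      -- in the original coordinates the local stable manifold is the graph `x = w y`
      AnalyticAt ℝ w (SecondOrderEq.xbar α β) ∧
      (∀ N ∈ 𝓝 (SecondOrderEq.fixedPt α β), N ⊆ N₀ →
        (∀ q ∈ SecondOrderEq.localStableManifold (SecondOrderEq.T α β)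
            (SecondOrderEq.fixedPt α β) N, q.1 = w q.2) ∧
        (∀ᶠ y in 𝓝 (SecondOrderEq.xbar α β), (w y, y) ∈
          SecondOrderEq.localStableManifold (SecondOrderEq.T α β)
            (SecondOrderEq.fixedPt α β) N)) ∧
      -- near the fixed point `S = 0` is the graph `x = ψt y`, with the stated value and slope
      (∀ᶠ q in 𝓝 (SecondOrderEq.fixedPt α β),
        SecondOrderEq.S α β q.1 q.2 = 0 ↔ q.1 = ψt q.2) ∧
      (∀ᶠ y in 𝓝 (SecondOrderEq.xbar α β), SecondOrderEq.S α β (ψt y) y = 0) ∧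
      ψt (SecondOrderEq.xbar α β) = SecondOrderEq.xbar α β ∧
      HasDerivAt ψt (2 * SecondOrderEq.xbar α β / (SecondOrderEq.theta α β - 1))
        (SecondOrderEq.xbar α β) ∧
      -- the two graphs agree up to an error of order four
      (fun y : ℝ => w y - ψt y) =O[𝓝 (SecondOrderEq.xbar α β)]
        (fun y : ℝ => (y - SecondOrderEq.xbar α β) ^ 4) := by
  have hX := one_le_xbar hα0 hβ0 hβ1
  have hX0 : xbar α β ≠ 0 := by positivity
  have hXeq : xbar α β * (1 - β) = 1 + α := div_mul_cancel₀ _ (by linarith)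
  have hθ1 := one_lt_theta hβ0 hX
  have hθ : theta α β ≠ 0 := by positivity
  have hl1 := lam1_lt_neg_one hα0 hα1 hβ0 hβ1
  have hl2 := lam2_pos hβ0 hX
  have h1 : 1 < |lam1 α β| := lt_abs.2 (Or.inr (by linarith))
  have h2 : |lam2 α β| < 1 := abs_lt.2 ⟨by linarith, lam2_lt_one hα0 hβ0 hβ1⟩
  have hsum := xbar_mul_lam_add hX
  have hprod := xbar_mul_lam_mul hβ0 hX
  have hθ2 := theta_sq hβ0 hX
  -- The direction `(1, λ₂)` of the decaying solution has `ξ`-coordinate `0` and, by `hEta`,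
  -- `η`-coordinate `λ₂`: the first gives `ψ'(0) = 0`, the second admits `η` as a parameter.
  have hXi : gamma1 α β + gamma3 α β * lam2 α β = 0 := by
    have : lam2 α β = (theta α β - 1) / (2 * xbar α β) := by rw [lam2]; ring
    rw [this, gamma1, gamma3]
    field_simp
    linear_combination hθ2
  have hEta : -gamma1 α β + gamma2 α β * lam2 α β = lam2 α β := by
    have h3 : gamma2 α β = 1 - gamma3 α β := by rw [gamma2, gamma3]; field_simp; ring
    linear_combination lam2 α β * h3 - hXi
  have hℓη : initialFunctional (-gamma1 α β) (gamma2 α β) (geom (lam2 α β) h2) = lam2 α β := by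
    simpa using hEta
  have hℓw : (evalCLM ℝ 1 : (ℕ →ᵇ ℝ) →L[ℝ] ℝ) (geom (lam2 α β) h2) = lam2 α β := by simp
  obtain ⟨hη, hηan, hη0, hηd, hηsol, hηuniq⟩ := exists_analyticAt_curve_residual hX0 h1 h2 hsum
    hprod (hℓη.trans_ne hl2.ne')
  obtain ⟨hw, hwan, hw0, -, hwsol, hwuniq⟩ := exists_analyticAt_curve_residual hX0 h1 h2 hsum
    hprod (hℓw.trans_ne hl2.ne')
  have hconv := eventually_tendsto_of_residual_eq_zero hX0 h1 h2 hsum hprod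
  rw [hℓη] at hηd
  have hηlim : Tendsto hη (𝓝 0) (𝓝 0) := by simpa [ContinuousAt, hη0] using hηan.continuousAt
  have hsublim : Tendsto (fun y => y - xbar α β) (𝓝 (xbar α β)) (𝓝 0) :=
    tendsto_sub_nhds_zero_iff.2 tendsto_id
  have hwlim : Tendsto (fun y => hw (y - xbar α β)) (𝓝 (xbar α β)) (𝓝 0) := by
    have h3 : Tendsto hw (𝓝 0) (𝓝 0) := by simpa [ContinuousAt, hw0] using hwan.continuousAt
    exact h3.comp hsublim
  set ψ : ℝ → ℝ := fun η => xiCoord α β (hη η 0) (hη η 1) with hψdef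
  set w : ℝ → ℝ := fun y => xbar α β + hw (y - xbar α β) 0 with hwdef
  have hψeq : ψ = fun η => initialFunctional (gamma1 α β) (gamma3 α β) (hη η) := rfl
  have hψan : AnalyticAt ℝ ψ 0 := by
    rw [hψeq]
    exact ((initialFunctional (gamma1 α β) (gamma3 α β)).analyticAt _).fun_comp hηan
  have hψ0 : ψ 0 = 0 := by simp [hψeq, hη0]
  have hψ1 : HasDerivAt ψ 0 0 := by
    rw [hψeq]
    refine ((initialFunctional (gamma1 α β) (gamma3 α β)).hasFDerivAt.comp_hasDerivAt 0
      hηd).congr_deriv ?_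
    rw [map_smul, initialFunctional_apply]
    simp [hXi]
  have hwan' : AnalyticAt ℝ w (xbar α β) := by
    have h3 : AnalyticAt ℝ (fun y => y - xbar α β) (xbar α β) := analyticAt_id.sub analyticAt_const
    have h4 : AnalyticAt ℝ hw (xbar α β - xbar α β) := by rwa [sub_self]
    exact analyticAt_const.add (((evalCLM ℝ 0 : (ℕ →ᵇ ℝ) →L[ℝ] ℝ).analyticAt _).fun_comp
      (h4.fun_comp (f := fun y => y - xbar α β) h3))
  have hwX : w (xbar α β) = xbar α β := by simp [hwdef, hw0]
  have hinv : ∀ᶠ η in 𝓝 (0 : ℝ), ψ (lam2 α β * η + g α β (ψ η) η) =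
      lam1 α β * ψ η + f α β (ψ η) η := by
    have hshift : Tendsto (fun η => shift (hη η)) (𝓝 0) (𝓝 0) := by
      have := (shift.continuous.tendsto 0).comp hηlim
      rwa [map_zero] at this
    have hne : Tendsto (fun η => xbar α β + hη η 1) (𝓝 0) (𝓝 (xbar α β)) := by
      simpa using (((evalCLM ℝ 1 : (ℕ →ᵇ ℝ) →L[ℝ] ℝ).continuous.tendsto 0).comp hηlim).const_add
        (xbar α β)
    filter_upwards [hηsol, hshift.eventually hηuniq, hne.eventually_ne hX0] with η hs hu hn
    have hη' : etaCoord α β (hη η 0) (hη η 1) = η := hs.2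
    have h3 := hu (by rw [residual_shift, hs.1, map_zero])
    have h4 := DFunLike.congr_fun hs.1 0
    obtain ⟨h5, h6⟩ := coord_of_recurrence hβ0 hX (u := hη η 0) (w := hη η 2) hn h4
    rw [hη'] at h5 h6
    rw [← h6, ← h5]
    show xiCoord α β (hη (initialFunctional (-gamma1 α β) (gamma2 α β) (shift (hη η))) 0)
      (hη (initialFunctional (-gamma1 α β) (gamma2 α β) (shift (hη η))) 1) = _
    rw [h3]
    rfl
  have hO := isBigO_sub_b2_b3 hβ0 hX hl1 hψan hψ0 hψ1 hinv
  obtain ⟨ψt, hSiff, hS0, hψt0, hψtd⟩ := exists_graph_S hβ0 hX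
  -- A single neighbourhood serves both parametrizations, so the same `N₀` works for `ψ` and `w`.
  have hboth : ∀ᶠ u in 𝓝 (0 : ℕ →ᵇ ℝ), residual (xbar α β) β u = 0 →
      hη (initialFunctional (-gamma1 α β) (gamma2 α β) u) = u ∧ hw (u 1) = u := by
    filter_upwards [hηuniq, hwuniq] with u h3 h4 hu
    exact ⟨h3 hu, h4 hu⟩
  obtain ⟨N₀, hN₀, hpos, hN₀mem⟩ := exists_nhds_localStableManifold hXeq hX hboth
  refine ⟨ψ, w, ψt, N₀, hN₀, hpos, hψan, hψ0, hψ1, fun N hN hNN => ⟨?_, ?_⟩, hinv, hO, hwan',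
    fun N hN hNN => ⟨?_, ?_⟩, hSiff, hS0, hψt0, hψtd, ?_⟩
  · intro q hq
    obtain ⟨u, ⟨hu, -⟩, rfl⟩ := hN₀mem N hNN q hq
    refine ⟨etaCoord α β (u 0) (u 1), ?_⟩
    have h3 : ψ (etaCoord α β (u 0) (u 1)) = xiCoord α β (u 0) (u 1) := by
      show xiCoord α β (hη (initialFunctional (-gamma1 α β) (gamma2 α β) u) 0)
        (hη (initialFunctional (-gamma1 α β) (gamma2 α β) u) 1) = _
      rw [hu]
    rw [h3, eigenPt_xiCoord_etaCoord hβ0 hX]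
  · filter_upwards [hηsol, hηlim.eventually
      (eventually_mem_localStableManifold hXeq hX hconv hN)] with η hs hmem
    have hη' : etaCoord α β (hη η 0) (hη η 1) = η := hs.2
    have h3 := eigenPt_xiCoord_etaCoord hβ0 hX (hη η 0) (hη η 1)
    rw [hη'] at h3
    show eigenPt α β (xiCoord α β (hη η 0) (hη η 1)) η ∈ _
    rw [h3]
    exact hmem hs.1
  · intro q hq
    obtain ⟨u, ⟨-, hu⟩, rfl⟩ := hN₀mem N hNN q hq
    simp [hwdef, hu]
  · filter_upwards [hsublim.eventually hwsol, hwlim.eventually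
      (eventually_mem_localStableManifold hXeq hX hconv hN)] with y hs hmem
    have h3 : hw (y - xbar α β) 1 = y - xbar α β := hs.2
    have h4 := hmem hs.1
    rwa [h3, add_sub_cancel] at h4
  · refine (isBigO_sub_of_S hβ0 hX hwan'.continuousAt hψtd.continuousAt hwX hψt0 hS0).trans ?_
    -- `η y` is the `η`-coordinate of `(w y, y)` and is `O(y - x̄)`, so the fourth-order remainder
    -- of `ψ` transfers to `y`.
    set η : ℝ → ℝ := fun y => etaCoord α β (w y - xbar α β) (y - xbar α β) with hηdef
    have hηdiff : DifferentiableAt ℝ η (xbar α β) := by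
      have := hwan'.differentiableAt
      simp only [hηdef, etaCoord]
      fun_prop
    have hηX : η (xbar α β) = 0 := by simp [hηdef, hwX, etaCoord]
    have hηO : η =O[𝓝 (xbar α β)] fun y => y - xbar α β := by
      simpa [hηX] using hηdiff.isBigO_sub
    have hηt : Tendsto η (𝓝 (xbar α β)) (𝓝 0) := by
      simpa [ContinuousAt, hηX] using hηdiff.continuousAt
    refine EventuallyEq.trans_isBigO ?_ ((hO.comp_tendsto hηt).trans (hηO.pow 4))
    filter_upwards [hsublim.eventually hwsol, hwlim.eventually hηuniq] with y hs hu
    have h3 : hw (y - xbar α β) 1 = y - xbar α β := hs.2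
    have h4 : w y - xbar α β = hw (y - xbar α β) 0 := by simp [hwdef]
    have h5 : ψ (η y) = xiCoord α β (w y - xbar α β) (y - xbar α β) := by
      have h6 : η y = initialFunctional (-gamma1 α β) (gamma2 α β) (hw (y - xbar α β)) := by
        simp only [hηdef, initialFunctional_apply, etaCoord, h3, h4]
      simp only [hψdef]
      rw [h6, hu hs.1, h3, h4]
    have h7 := S_xbar_add (α := α) (β := β) (w y - xbar α β) (y - xbar α β)
    rw [add_sub_cancel, add_sub_cancel, ← h5] at h7
    exact h7
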